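/- A correlation clustering instance consists of a finite vertex set $V$, a splitting of the set of all unordered pairs of distinct vertices into positive edges $E^+$ and negative edges $E^-$, and edge weights $\mathbf w_e$. It is an instance with asymmetric classification errors with parameter $\alpha\in(0,1]$ if for some $\mathbf w>0$ every positive edge has weight in $[\alpha\mathbf w,\mathbf w]$ and every negative edge has weight in $[\alpha\mathbf w,\infty)$. The cost of a clustering (a partition of $V$) is the total weight of the positive edges between different clusters and the negative edges inside clusters; $\mathrm{OPT}$ is the minimum cost. The natural LP relaxation minimizes $\sum_{uv\in E^+}\mathbf w_{uv}x_{uv}+\sum_{uv\in E^-}\mathbf w_{uv}(1-x_{uv})$ subject to $x_{uw}\le x_{uv}+x_{vw}$, $x_{uv}=x_{vu}$, $x_{uu}=0$ and $x_{uv}\in[0,1]$ for all $u,v,w\in V$; $\mathrm{LP}$ is its optimal value. Theorem 3. The LP relaxation has integrality gap $\Omega(\log 1/\alpha)$ on instances with asymmetric classification errors: there is an absolute constant $c>0$ such that for every $\alpha\in(0,1]$ there is an instance with parameter $\alpha$ with $\mathrm{LP}>0$ and $\mathrm{OPT}\ge c\log(1/\alpha)\cdot\mathrm{LP}$. For small $\alpha$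 this gap is attained by expanders, as follows. Call a $3$-regular graph $G=(V,E)$ an $h$-expander if at least $h|S|$ edges leave every $S\subseteq V$ with $|S|\le|V|/2$. (i) There are constants $h,a,b>0$ and $\alpha_0\in(0,1)$ such that for every $\alpha\in(0,\alpha_0]$ there is a $3$-regular $h$-expander whose number $n$ of vertices satisfies $a(\alpha\log\alpha)^{-2}\le n\le b(\alpha\log\alpha)^{-2}$. (ii) For all $h,a,b>0$ there are $c,C>0$ and $\alpha_0\in(0,1)$ such that the following holds for every $\alpha\in(0,\alpha_0]$ and every $3$-regular $h$-expander $G=(V,E)$ on $n$ vertices with $a(\alpha\log\alpha)^{-2}\le n\le b(\alpha\log\alpha)^{-2}$. Let $E^+=E$ with weights $1$, and let $E^-$ consist of all non-adjacent pairs of distinct vertices, with weights $\alpha$. This is an instance with parameter $\alpha$; the truncated scaled shortest-path metric $x_{uv}=\min(2d_G(u,v)/\log_3 n,\,1)$ is a feasible LP solution of cost at most $Cn/\log(1/\alpha)$; every clustering costs at least $cn$; and $\mathrm{LP}>0$ and $\mathrm{OPT}\ge c\log(1/\alpha)\cdot\mathrm{LP}$. -/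

import Mathlib

/-- An instance of correlation clustering on the complete graph with vertex set `V`.
The positive edges are the edges of `pos`, every other pair of distinct vertices is a negative
edge, and `weight e` is the weight of the edge `e` (its values on the diagonal of `Sym2 V`
are never used). -/
structure CorrelationClustering (V : Type*) where
  pos : SimpleGraph V
  weight : Sym2 V → ℝ

namespace CorrelationClustering

variable {V : Type*}

/-- The graph of negative edges. -/
def neg (I : CorrelationClustering V) : SimpleGraph V := I.posᶜ

/-- Asymmetric classification errors with parameter `α`: for some scale `w > 0`, the positive
edges have weights in `[α w, w]` and the negative edges have weights in `[α w, ∞)`. -/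
def IsAsymmetric (I : CorrelationClustering V) (α : ℝ) : Prop :=
  ∃ w : ℝ, 0 < w ∧
    (∀ e ∈ I.pos.edgeSet, α * w ≤ I.weight e ∧ I.weight e ≤ w) ∧
    (∀ e ∈ I.neg.edgeSet, α * w ≤ I.weight e)

/-- The pair `e` lies inside one cluster of the clustering `r`.  A clustering, that is a partition
of `V` into clusters, is given by the equivalence relation "in the same cluster". -/
def Within (r : Setoid V) (e : Sym2 V) : Prop := ∀ u ∈ e, ∀ v ∈ e, r u v

open Classical in
/-- The MinDisagree objective: the weight of the positive edges between clusters plus the weight of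
the negative edges inside clusters. -/
noncomputable def disagreement [Fintype V] (I : CorrelationClustering V) (r : Setoid V) : ℝ :=
  (∑ e ∈ I.pos.edgeFinset with ¬ Within r e, I.weight e) +
    ∑ e ∈ I.neg.edgeFinset with Within r e, I.weight e

/-- The cost of an optimal (integral) clustering. -/
noncomputable def optValue [Fintype V] (I : CorrelationClustering V) : ℝ :=
  sInf (Set.range I.disagreement)

/-- The feasible solutions of the metric LP relaxation.  Lengths are functions of unordered pairs,
so that `x_{uv} = x_{vu}` holds by construction. -/
structure IsFeasible (x : Sym2 V → ℝ) : Prop where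
  triangle : ∀ u v w : V, x s(u, w) ≤ x s(u, v) + x s(v, w)
  self : ∀ u : V, x s(u, u) = 0
  mem_Icc : ∀ u v : V, x s(u, v) ∈ Set.Icc (0 : ℝ) 1

open Classical in
/-- The objective of the LP relaxation. -/
noncomputable def lpCost [Fintype V] (I : CorrelationClustering V) (x : Sym2 V → ℝ) : ℝ :=
  (∑ e ∈ I.pos.edgeFinset, I.weight e * x e) +
    ∑ e ∈ I.neg.edgeFinset, I.weight e * (1 - x e)

/-- The optimal value of the LP relaxation. -/
noncomputable def lpValue [Fintype V] (I : CorrelationClustering V) : ℝ :=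
  sInf (I.lpCost '' {x | IsFeasible x})

open Classical in
/-- The instance of a graph `G`: the edges of `G` are positive with weight `1`, the non-edges
are negative with weight `α`. -/
noncomputable def ofGraph (G : SimpleGraph V) (α : ℝ) : CorrelationClustering V where
  pos := G
  weight e := if e ∈ G.edgeSet then 1 else α

/-- The truncated scaled shortest-path metric `x_{uv} = min (ε d(u, v), 1)` of `G`. -/
noncomputable def truncatedMetric (G : SimpleGraph V) (ε : ℝ) : Sym2 V → ℝ :=
  Sym2.lift ⟨fun u v => min (ε * (G.dist u v : ℝ)) 1, fun u v => by
    simp only [SimpleGraph.dist_comm]⟩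

open Classical in
/-- `G` is a `3`-regular graph with edge expansion at least `h`: at least `h |S|` edges leave
every set `S` of at most half of the vertices. -/
def IsCubicExpander [Fintype V] (G : SimpleGraph V) (h : ℝ) : Prop :=
  G.IsRegularOfDegree 3 ∧
    ∀ S : Finset V, 2 * S.card ≤ Fintype.card V → h * S.card ≤ ((G.interedges S Sᶜ).card : ℝ)

end CorrelationClustering

/-! On a bounded-degree expander the LP can spread the vertices cheaply, while a clustering must cut
linearly many edges or keep a giant cluster. Put L = log_3 n. Each of the 3n/2 edges has length at
most 2/L, so the positive part costs at most 3n/L. A negative pair costs something only if its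
distance is below L/2; a ball of that radius has at most 2√n vertices, so the negative part costs at
most 2αn√n. For n of order (α log α)⁻² both parts are O(n / log(1/α)) (`lpCost_truncatedMetric_le`).

For a clustering there are two cases. If every cluster has at most n/2 vertices, expansion of each
cluster gives at least hn/2 cut edges. Otherwise one cluster contains at least n²/16 negative pairs,
of cost αn²/16 ≥ n, because αn ≥ 16 for small α (`IsCubicExpander.le_disagreement`). For α bounded
away from 0, log(1/α) is bounded and a path on three vertices suffices.

Expanders come from the union bound: some 20 permutations expand every set of at most half of the
points (`exists_perms_expanding`). Replacing each point by a 40-cycle makes the resulting 40-regular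
multigraph cubic and costs only a constant factor in expansion (`replacementGraph_isCubicExpander`).
-/

/-! ### Expansion of random permutations. -/

/-- Double counting of the pairs (A, π) with |A| = |S| and π(A) ⊆ T. The count for fixed A does not
depend on A, since right multiplication by a permutation carrying S to A is a bijection. -/
theorem card_perm_map_subset_mul_choose {V : Type*} [Fintype V] [DecidableEq V] (S T : Finset V) :
    (Finset.univ.filter fun π : Equiv.Perm V => S.map π.toEmbedding ⊆ T).card *
      (Fintype.card V).choose S.card = (Fintype.card V).factorial * T.card.choose S.card := by
  have symm : ∀ A ∈ Finset.powersetCard S.card (Finset.univ : Finset V),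
      (Finset.univ.filter fun π : Equiv.Perm V => A.map π.toEmbedding ⊆ T).card =
      (Finset.univ.filter fun π : Equiv.Perm V => S.map π.toEmbedding ⊆ T).card := by
    intro A hA
    obtain ⟨σ, rfl⟩ := Equiv.Perm.exists_map_finset_eq S A (Finset.mem_powersetCard.1 hA).2.symm
    refine Finset.card_equiv (Equiv.mulRight σ) fun π => ?_
    simp only [Finset.mem_filter, Finset.mem_univ, true_and, Finset.map_map]
    rfl
  have count := Finset.sum_card_bipartiteAbove_eq_sum_card_bipartiteBelow
    (fun (A : Finset V) (π : Equiv.Perm V) => A.map π.toEmbedding ⊆ T)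
    (s := Finset.powersetCard S.card Finset.univ) (t := Finset.univ)
  have below : ∀ π ∈ (Finset.univ : Finset (Equiv.Perm V)),
      ((Finset.powersetCard S.card Finset.univ).filter fun A => A.map π.toEmbedding ⊆ T).card =
        T.card.choose S.card := by
    intro π _
    rw [← Finset.card_map π.symm.toEmbedding (s := T), ← Finset.card_powersetCard]
    congr 1
    ext A
    simp only [Finset.mem_filter, Finset.mem_powersetCard, Finset.subset_univ, true_and]
    rw [and_comm, and_congr_left_iff]
    intro _
    simp only [Finset.subset_iff, Finset.mem_map_equiv, Equiv.symm_symm]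
    exact ⟨fun h x hx => h (by simpa using hx), fun h x hx => by simpa using h hx⟩
  simp only [Finset.bipartiteAbove, Finset.bipartiteBelow] at count
  rw [Finset.sum_congr rfl symm, Finset.sum_congr rfl below] at count
  simpa [Finset.card_univ, Fintype.card_perm, mul_comm] using count

/-- The ratio of the binomials is the product of the factors (t - i)/(n - i), each at most t/n. -/
theorem choose_mul_pow_le {n t : ℕ} (h : t ≤ n) (s : ℕ) :
    t.choose s * n ^ s ≤ n.choose s * t ^ s := by
  induction s with
  | zero => simp
  | succ s ih =>
    have h1 : (t - s) * n ≤ (n - s) * t := by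
      rw [Nat.sub_mul, Nat.sub_mul, mul_comm n t]
      exact Nat.sub_le_sub_left (Nat.mul_le_mul_left s h) _
    refine Nat.le_of_mul_le_mul_right (c := s + 1) ?_ s.succ_pos
    calc t.choose (s + 1) * n ^ (s + 1) * (s + 1)
        = (t.choose (s + 1) * (s + 1)) * n ^ (s + 1) := by ring
      _ = (t.choose s * n ^ s) * ((t - s) * n) := by rw [Nat.choose_succ_right_eq]; ring
      _ ≤ (n.choose s * t ^ s) * ((n - s) * t) := Nat.mul_le_mul ih h1
      _ = (n.choose (s + 1) * (s + 1)) * t ^ (s + 1) := by rw [Nat.choose_succ_right_eq]; ring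
      _ = _ := by ring

theorem card_perm_map_subset_le {V : Type*} [Fintype V] [DecidableEq V] (S T : Finset V)
    (hS : S.Nonempty) :
    ((Finset.univ.filter fun π : Equiv.Perm V => S.map π.toEmbedding ⊆ T).card : ℝ) ≤
      (Fintype.card V).factorial * (T.card / Fintype.card V : ℝ) ^ S.card := by
  have hn : 0 < Fintype.card V := Fintype.card_pos_iff.2 ⟨hS.choose⟩
  have hc : 0 < (Fintype.card V).choose S.card := Nat.choose_pos S.card_le_univ
  have e := card_perm_map_subset_mul_choose S T
  have i := choose_mul_pow_le T.card_le_univ S.card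
  rw [div_pow, ← mul_div_assoc, le_div_iff₀ (by positivity)]
  have : (Finset.univ.filter fun π : Equiv.Perm V => S.map π.toEmbedding ⊆ T).card *
      Fintype.card V ^ S.card ≤ (Fintype.card V).factorial * T.card ^ S.card := by
    refine Nat.le_of_mul_le_mul_right (c := (Fintype.card V).choose S.card) ?_ hc
    calc _ = (Fintype.card V).factorial * (T.card.choose S.card * Fintype.card V ^ S.card) := by
            rw [mul_right_comm, e, mul_assoc]
      _ ≤ (Fintype.card V).factorial * ((Fintype.card V).choose S.card * T.card ^ S.card) :=
            Nat.mul_le_mul_left _ i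
      _ = _ := by ring
  exact_mod_cast this

theorem choose_le_three_mul_div_pow (n s : ℕ) (hs : 0 < s) :
    (n.choose s : ℝ) ≤ (3 * n / s) ^ s := by
  have h1 : (n.choose s : ℝ) ≤ (n : ℝ) ^ s / s.factorial := Nat.choose_le_pow_div s n
  have h2 : (s : ℝ) ^ s / s.factorial ≤ 3 ^ s := by
    refine (Real.pow_div_factorial_le_exp s (by positivity) s).trans ?_
    rw [← Real.exp_one_pow]
    exact pow_le_pow_left₀ (Real.exp_pos 1).le Real.exp_one_lt_three.le s
  rw [div_le_iff₀ (by positivity)] at h2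
  refine h1.trans ?_
  rw [div_pow, mul_pow, div_le_div_iff₀ (by positivity) (by positivity)]
  calc (n : ℝ) ^ s * s ^ s ≤ (n : ℝ) ^ s * (3 ^ s * s.factorial) := by gcongr
    _ = _ := by ring

theorem choose_le_choose_of_le_half {n r s : ℕ} (hrs : r ≤ s) (hs : s ≤ n / 2) :
    n.choose r ≤ n.choose s := by
  induction s, hrs using Nat.le_induction with
  | base => rfl
  | succ k _ ih => exact (ih (by omega)).trans (Nat.choose_le_succ_of_lt_half_left (by omega))

/-- The union bound for sets of size s: at most C(n, s)² bad events, each of probability at most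
(3s/2n)^(20s). Two of the twenty factors cancel the binomials up to (81/4)^s; the other 18 make the
bound geometric in s. -/
theorem choose_sq_mul_pow_le {n s : ℕ} (hs : 0 < s) (h : 2 * s ≤ n) :
    (n.choose s : ℝ) ^ 2 * ((3 * s / (2 * n) : ℝ) ^ s) ^ 20 ≤ (1 / 3) ^ s := by
  have hs' : (0 : ℝ) < s := by exact_mod_cast hs
  have h' : (2 : ℝ) * s ≤ n := by exact_mod_cast h
  have hn' : (0 : ℝ) < n := by linarith
  have hy : (3 * s / (2 * n) : ℝ) ≤ 3 / 4 := by
    rw [div_le_div_iff₀ (by positivity) (by norm_num)]; linarith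
  calc (n.choose s : ℝ) ^ 2 * ((3 * s / (2 * n) : ℝ) ^ s) ^ 20
      ≤ ((3 * n / s : ℝ) ^ s) ^ 2 * ((3 * s / (2 * n) : ℝ) ^ s) ^ 20 := by
        gcongr
        exact choose_le_three_mul_div_pow n s hs
    _ = (((3 * n / s : ℝ)) ^ 2 * (3 * s / (2 * n) : ℝ) ^ 20) ^ s := by
        rw [mul_pow, ← pow_mul, ← pow_mul, ← pow_mul, ← pow_mul, mul_comm s 2, mul_comm s 20]
    _ = (81 / 4 * (3 * s / (2 * n) : ℝ) ^ 18) ^ s := by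
        congr 1
        field_simp
        norm_num
    _ ≤ (81 / 4 * (3 / 4 : ℝ) ^ 18) ^ s := by gcongr
    _ ≤ (1 / 3) ^ s := by gcongr; norm_num

theorem exists_perms_expanding (V : Type*) [Fintype V] [DecidableEq V] :
    ∃ π : Fin 20 → Equiv.Perm V, ∀ S : Finset V, S.Nonempty → 2 * S.card ≤ Fintype.card V →
      S.card / 2 < ((Finset.univ.biUnion fun i => S.map (π i).toEmbedding) \ S).card := by
  classical
  set n := Fintype.card V with hn
  by_contra! H
  let bad (p : Finset V × Finset V) : Finset (Fin 20 → Equiv.Perm V) :=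
    Fintype.piFinset fun _ => Finset.univ.filter fun π => p.1.map π.toEmbedding ⊆ p.1 ∪ p.2
  let I (s : ℕ) : Finset (Finset V × Finset V) :=
    Finset.powersetCard s Finset.univ ×ˢ Finset.powersetCard (s / 2) Finset.univ
  have cover : (Finset.univ : Finset (Fin 20 → Equiv.Perm V)) ⊆
      (Finset.Icc 1 (n / 2)).biUnion fun s => (I s).biUnion bad := by
    intro π _
    obtain ⟨S, hS, hSn, hle⟩ := H π
    -- Enlarging the set of new points to exactly |S|/2 elements (rounded down) makes the events
    -- indexed by pairs of prescribed sizes.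
    obtain ⟨U, hU, hUc⟩ := Finset.exists_superset_card_eq hle (by omega)
    have := hS.card_pos
    refine Finset.mem_biUnion.2 ⟨S.card, Finset.mem_Icc.2 ⟨this, by omega⟩,
      Finset.mem_biUnion.2 ⟨(S, U), by simp [I, hUc], ?_⟩⟩
    simp only [bad, Fintype.mem_piFinset, Finset.mem_filter, Finset.mem_univ, true_and]
    intro i x hx
    by_cases hxS : x ∈ S
    · exact Finset.mem_union_left _ hxS
    · exact Finset.mem_union_right _ (hU (Finset.mem_sdiff.2
        ⟨Finset.mem_biUnion.2 ⟨i, Finset.mem_univ _, hx⟩, hxS⟩))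
  have hbad : ∀ s ∈ Finset.Icc 1 (n / 2), ∀ p ∈ I s, ((bad p).card : ℝ) ≤
      (n.factorial * (3 * s / (2 * n) : ℝ) ^ s) ^ 20 := by
    rintro s hs ⟨S, U⟩ hp
    simp only [I, Finset.mem_product, Finset.mem_powersetCard, Finset.subset_univ, true_and] at hp
    obtain ⟨rfl, hU⟩ := hp
    have hs1 := (Finset.mem_Icc.1 hs).1
    simp only [bad, Fintype.card_piFinset, Finset.prod_const, Finset.card_univ, Fintype.card_fin,
      Nat.cast_pow]
    gcongr
    refine (card_perm_map_subset_le S (S ∪ U) (Finset.card_pos.1 hs1)).trans ?_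
    gcongr ?_ * ?_ ^ _
    rw [← hn, mul_comm (2 : ℝ), ← div_div, div_right_comm]
    gcongr
    rw [le_div_iff₀ two_pos]
    have := Finset.card_union_le S U
    have : (S ∪ U).card * 2 ≤ 3 * S.card := by omega
    exact_mod_cast this
  have hcard : ∀ s ∈ Finset.Icc 1 (n / 2), ((I s).card : ℝ) ≤ (n.choose s : ℝ) ^ 2 := by
    intro s hs
    have := choose_le_choose_of_le_half (Nat.div_le_self s 2) (Finset.mem_Icc.1 hs).2
    simp only [I, Finset.card_product, Finset.card_powersetCard, Finset.card_univ, ← hn]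
    rw [sq]
    exact_mod_cast Nat.mul_le_mul_left _ this
  have hfac : (0 : ℝ) < (n.factorial : ℝ) ^ 20 := by positivity
  have geom : ∀ m : ℕ, ∑ s ∈ Finset.Icc 1 m, (1 / 3 : ℝ) ^ s ≤ 1 / 2 := by
    intro m
    have : ∑ s ∈ Finset.Icc 1 m, (1 / 3 : ℝ) ^ s = 1 / 2 - (1 / 3) ^ m / 2 := by
      induction m with
      | zero => simp
      | succ m ih => rw [Finset.sum_Icc_succ_top (by omega), ih]; ring
    rw [this]
    have : (0 : ℝ) < (1 / 3) ^ m := by positivity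
    linarith
  have total : (n.factorial : ℝ) ^ 20 ≤ (n.factorial : ℝ) ^ 20 * (1 / 2) := by
    calc (n.factorial : ℝ) ^ 20
        = ((Finset.univ : Finset (Fin 20 → Equiv.Perm V)).card : ℝ) := by
          simp [Finset.card_univ, Fintype.card_perm, hn]
      _ ≤ ∑ s ∈ Finset.Icc 1 (n / 2), ∑ p ∈ I s, ((bad p).card : ℝ) := by
          have := (Finset.card_le_card cover).trans (Finset.card_biUnion_le.trans
            (Finset.sum_le_sum fun s _ => Finset.card_biUnion_le))
          exact_mod_cast this
      _ ≤ ∑ s ∈ Finset.Icc 1 (n / 2), (n.factorial : ℝ) ^ 20 * (1 / 3) ^ s := by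
          refine Finset.sum_le_sum fun s hs => ?_
          obtain ⟨h1, h2⟩ := Finset.mem_Icc.1 hs
          calc ∑ p ∈ I s, ((bad p).card : ℝ)
              ≤ (I s).card • (n.factorial * (3 * s / (2 * n) : ℝ) ^ s) ^ 20 :=
                Finset.sum_le_card_nsmul _ _ _ (hbad s hs)
            _ ≤ (n.choose s : ℝ) ^ 2 * (n.factorial * (3 * s / (2 * n) : ℝ) ^ s) ^ 20 := by
                rw [nsmul_eq_mul]
                gcongr
                exact hcard s hs
            _ = (n.factorial : ℝ) ^ 20 *
                  ((n.choose s : ℝ) ^ 2 * ((3 * s / (2 * n) : ℝ) ^ s) ^ 20) := by ring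
            _ ≤ _ := by
                gcongr
                exact choose_sq_mul_pow_le h1 (by omega)
      _ ≤ (n.factorial : ℝ) ^ 20 * (1 / 2) := by
          rw [← Finset.mul_sum]
          gcongr
          exact geom _
  linarith

/-! ### Cubic expanders by replacement. -/

namespace CorrelationClustering

/-- The permutation used by the port `i` of a cloud in the replacement graph: the ports `i < 20` use
`π i`, the ports `i + 20` its inverse. -/
def portPerm {V : Type*} (π : Fin 20 → Equiv.Perm V) (i : ZMod 40) : Equiv.Perm V :=
  if i.val < 20 then π ⟨i.val % 20, Nat.mod_lt _ (by norm_num)⟩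
  else (π ⟨i.val % 20, Nat.mod_lt _ (by norm_num)⟩)⁻¹

/-- Crossing from port i to port i + 20 and back returns to the start; this makes the adjacency
below symmetric. -/
theorem portPerm_add_twenty {V : Type*} (π : Fin 20 → Equiv.Perm V) (i : ZMod 40) :
    portPerm π (i + 20) = (portPerm π i)⁻¹ := by
  have h1 : ∀ i : ZMod 40, (i + 20).val % 20 = i.val % 20 := by decide
  have h2 : ∀ i : ZMod 40, (i + 20).val < 20 ↔ ¬ i.val < 20 := by decide
  unfold portPerm
  simp only [h1, h2]
  by_cases h : i.val < 20 <;> simp [h]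

theorem portPerm_natCast {V : Type*} (π : Fin 20 → Equiv.Perm V) (i : Fin 20) :
    portPerm π ((i : ℕ) : ZMod 40) = π i := by
  have h : ((i : ℕ) : ZMod 40).val = i := ZMod.val_natCast_of_lt (by omega)
  unfold portPerm
  simp only [h, i.isLt, if_true, Nat.mod_eq_of_lt]

/-- The replacement graph of the Schreier graph of `20` permutations: each vertex is replaced by
a cycle of `40` ports, and each edge by an edge between two ports. -/
def replacementGraph {V : Type*} (π : Fin 20 → Equiv.Perm V) : SimpleGraph (V × ZMod 40) where
  Adj x y := (x.1 = y.1 ∧ (y.2 = x.2 + 1 ∨ x.2 = y.2 + 1)) ∨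
    (y.2 = x.2 + 20 ∧ y.1 = portPerm π x.2 x.1)
  symm := ⟨by
    rintro ⟨u, i⟩ ⟨v, j⟩ (⟨h, h'⟩ | ⟨h, h'⟩)
    · exact Or.inl ⟨h.symm, h'.symm⟩
    · have : ∀ i : ZMod 40, i = i + 20 + 20 := by decide
      dsimp only at h h'
      subst h h'
      exact Or.inr ⟨this i, by simp [portPerm_add_twenty]⟩⟩
  loopless := ⟨by
    have : ∀ i : ZMod 40, i ≠ i + 1 ∧ i ≠ i + 20 := by decide
    rintro ⟨u, i⟩ (⟨-, h | h⟩ | ⟨h, -⟩)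
    · exact (this i).1 h
    · exact (this i).1 h
    · exact (this i).2 h⟩

theorem replacementGraph_adj {V : Type*} (π : Fin 20 → Equiv.Perm V) (x y : V × ZMod 40) :
    (replacementGraph π).Adj x y ↔ (x.1 = y.1 ∧ (y.2 = x.2 + 1 ∨ x.2 = y.2 + 1)) ∨
      (y.2 = x.2 + 20 ∧ y.1 = portPerm π x.2 x.1) := Iff.rfl

theorem replacementGraph_isCubicExpander {V : Type*} [Fintype V] [DecidableEq V]
    (π : Fin 20 → Equiv.Perm V)
    (hπ : ∀ S : Finset V, S.Nonempty → 2 * S.card ≤ Fintype.card V →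
      S.card / 2 < ((Finset.univ.biUnion fun i => S.map (π i).toEmbedding) \ S).card) :
    IsCubicExpander (replacementGraph π) (1 / 120) := by
  classical
  constructor
  · rintro ⟨u, i⟩
    have h : ∀ i : ZMod 40, i + 1 ≠ i - 1 ∧ i + 1 ≠ i + 20 ∧ i - 1 ≠ i + 20 := by decide
    obtain ⟨h1, h2, h3⟩ := h i
    have e : ({(u, i + 1), (u, i - 1), (portPerm π i u, i + 20)} : Finset (V × ZMod 40)).card = 3 :=
      Finset.card_eq_three.2 ⟨_, _, _, by simp [h1], by simp [h2], by simp [h3], rfl⟩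
    rw [← SimpleGraph.card_neighborFinset_eq_degree, ← e]
    congr 1
    ext ⟨v, j⟩
    have hj : i = j + 1 ↔ j = i - 1 := by rw [eq_sub_iff_add_eq, eq_comm]
    simp only [SimpleGraph.mem_neighborFinset, replacementGraph_adj, Finset.mem_insert,
      Finset.mem_singleton, Prod.mk.injEq, hj]
    rw [eq_comm (a := u)]
    tauto
  · intro S hS
    set B := (replacementGraph π).interedges S Sᶜ with hB
    -- A: clouds contained in S; M: clouds that S splits; U: clouds outside A reached from A. Each
    -- cloud of M and of U receives a boundary edge, so |M|, |U| ≤ |B|. With |A| ≤ 2|U| this gives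
    -- |S| ≤ 40(|A| + |M|) ≤ 120|B|.
    set A := Finset.univ.filter fun v => ∀ i, (v, i) ∈ S with hA
    set M := Finset.univ.filter fun v => (∃ i, (v, i) ∈ S) ∧ ∃ i, (v, i) ∉ S with hM
    set U := (Finset.univ.biUnion fun i => A.map (π i).toEmbedding) \ A with hU
    have hMB : M ⊆ B.image fun p => p.2.1 := by
      intro v hv
      simp only [hM, Finset.mem_filter, Finset.mem_univ, true_and] at hv
      obtain ⟨⟨i, hi⟩, j, hj⟩ := hv
      obtain ⟨k, hk, hk'⟩ : ∃ k, (v, k) ∈ S ∧ (v, k + 1) ∉ S := by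
        by_contra! H
        have step : ∀ m : ℕ, (v, i + m) ∈ S := by
          intro m
          induction m with
          | zero => simpa using hi
          | succ m ih =>
            have := H _ ih
            rwa [add_assoc, ← Nat.cast_succ] at this
        refine hj ?_
        have := step (j - i).val
        rwa [ZMod.natCast_zmod_val, add_sub_cancel] at this
      refine Finset.mem_image.2 ⟨((v, k), (v, k + 1)), ?_, rfl⟩
      rw [hB, SimpleGraph.mem_interedges_iff, Finset.mem_compl, replacementGraph_adj]
      exact ⟨hk, hk', Or.inl ⟨rfl, Or.inl rfl⟩⟩
    have hUB : U ⊆ B.image fun p => p.2.1 := by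
      intro v hv
      -- A cloud of U is not full, so if it is not split it misses S, and the edge arriving from a
      -- full cloud is a boundary edge.
      by_cases hvM : v ∈ M
      · exact hMB hvM
      simp only [hU, hM, hA, Finset.mem_sdiff, Finset.mem_biUnion, Finset.mem_map_equiv,
        Finset.mem_filter, Finset.mem_univ, true_and] at hv hvM
      obtain ⟨⟨i, hi⟩, hv⟩ := hv
      have hv' : ∀ i, (v, i) ∉ S := by
        intro i hi
        push Not at hv
        exact hvM ⟨⟨i, hi⟩, hv⟩
      refine Finset.mem_image.2 ⟨(((π i).symm v, ((i : ℕ) : ZMod 40)),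
        (v, ((i : ℕ) : ZMod 40) + 20)), ?_, rfl⟩
      rw [hB, SimpleGraph.mem_interedges_iff, Finset.mem_compl, replacementGraph_adj]
      refine ⟨hi _, hv' _, Or.inr ⟨rfl, ?_⟩⟩
      simp [portPerm_natCast]
    have hM' := (Finset.card_le_card hMB).trans Finset.card_image_le
    have hU' := (Finset.card_le_card hUB).trans Finset.card_image_le
    have hAS : 40 * A.card ≤ S.card := by
      have : A ×ˢ (Finset.univ : Finset (ZMod 40)) ⊆ S := by
        rintro ⟨v, i⟩ h
        simp only [hA, Finset.mem_product, Finset.mem_filter, Finset.mem_univ, true_and,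
          and_true] at h
        exact h i
      have := Finset.card_le_card this
      rwa [Finset.card_product, Finset.card_univ, ZMod.card, mul_comm] at this
    have hSAM : S.card ≤ 40 * (A.card + M.card) := by
      have : S ⊆ (A ∪ M) ×ˢ (Finset.univ : Finset (ZMod 40)) := by
        rintro ⟨v, i⟩ h
        simp only [hA, hM, Finset.mem_product, Finset.mem_filter, Finset.mem_univ, true_and,
          and_true, Finset.mem_union]
        by_cases hv : ∀ i, (v, i) ∈ S
        · exact Or.inl hv
        · push Not at hv
          exact Or.inr ⟨⟨i, h⟩, hv⟩
      have := Finset.card_le_card this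
      rw [Finset.card_product, Finset.card_univ, ZMod.card, mul_comm] at this
      exact this.trans (Nat.mul_le_mul_left _ (Finset.card_union_le _ _))
    rw [Fintype.card_prod, ZMod.card] at hS
    have hAU : A.card ≤ 2 * U.card := by
      rcases A.eq_empty_or_nonempty with h | h
      · simp [h]
      · have : A.card / 2 < U.card := by convert hπ A h (by omega)
        omega
    have : S.card ≤ 120 * B.card := by omega
    have : (S.card : ℝ) ≤ 120 * B.card := by exact_mod_cast this
    have : 1 / 120 * (S.card : ℝ) ≤ B.card := by linarith
    convert this

theorem IsCubicExpander.comap {V W : Type*} [Fintype V] [Fintype W] {G : SimpleGraph V} {h : ℝ}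
    (hG : IsCubicExpander G h) (e : W ≃ V) : IsCubicExpander (G.comap e) h := by
  classical
  constructor
  · intro w
    have := hG.1 (e w)
    rw [← this]
    exact ((SimpleGraph.Iso.comap e G).degree_eq w).symm
  · intro S hS
    have := hG.2 (S.map e.toEmbedding) (by rwa [Finset.card_map, ← Fintype.card_congr e])
    rw [Finset.card_map] at this
    refine this.trans ?_
    have le : (G.interedges (S.map e.toEmbedding) (S.map e.toEmbedding)ᶜ).card ≤
        ((G.comap e).interedges S Sᶜ).card := by
      refine Finset.card_le_card_of_injOn (Prod.map e.symm e.symm) ?_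
        (e.symm.injective.prodMap e.symm.injective).injOn
      rintro ⟨u, v⟩ huv
      simp only [Finset.mem_coe, SimpleGraph.mem_interedges_iff, Finset.mem_compl,
        Finset.mem_map_equiv] at huv ⊢
      simpa using huv
    exact_mod_cast le

/-- There are `3`-regular expanders on `40 m` vertices for each `m`. -/
theorem exists_isCubicExpander (m : ℕ) :
    ∃ G : SimpleGraph (Fin (m * 40)), IsCubicExpander G (1 / 120) := by
  obtain ⟨π, hπ⟩ := exists_perms_expanding (Fin m)
  exact ⟨_, (replacementGraph_isCubicExpander π hπ).comap
    (finProdFinEquiv (m := m) (n := 40)).symm⟩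

end CorrelationClustering

/-! ### The LP relaxation and its integral solutions. -/

namespace CorrelationClustering

theorem ofGraph_weight_of_mem {V : Type*} {G : SimpleGraph V} (α : ℝ) {e : Sym2 V}
    (he : e ∈ (ofGraph G α).pos.edgeSet) : (ofGraph G α).weight e = 1 := if_pos he

theorem ofGraph_weight_of_mem_compl {V : Type*} {G : SimpleGraph V} (α : ℝ) {e : Sym2 V}
    (he : e ∈ (ofGraph G α).neg.edgeSet) : (ofGraph G α).weight e = α := by
  refine if_neg ?_
  induction e with
  | _ u v =>
    exact (SimpleGraph.mem_edgeSet _).not.2 ((SimpleGraph.compl_adj _ _ _).1 he).2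

theorem ofGraph_weight_nonneg {V : Type*} (G : SimpleGraph V) {α : ℝ} (hα : 0 ≤ α) (e : Sym2 V) :
    0 ≤ (ofGraph G α).weight e := by
  unfold ofGraph
  dsimp only
  split_ifs
  · exact zero_le_one
  · exact hα

theorem ofGraph_isAsymmetric {V : Type*} (G : SimpleGraph V) {α : ℝ} (hα : α ≤ 1) :
    (ofGraph G α).IsAsymmetric α := by
  refine ⟨1, one_pos, fun e he => ?_, fun e he => ?_⟩
  · rw [ofGraph_weight_of_mem α he]
    simpa using hα
  · rw [ofGraph_weight_of_mem_compl α he, mul_one]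

theorem within_mk {V : Type*} (r : Setoid V) (u v : V) : Within r s(u, v) ↔ r u v := by
  refine ⟨fun h => h u (Sym2.mem_mk_left u v) v (Sym2.mem_mk_right u v), fun h x hx y hy => ?_⟩
  rw [Sym2.mem_iff] at hx hy
  rcases hx with rfl | rfl <;> rcases hy with rfl | rfl
  · exact r.refl _
  · exact h
  · exact r.symm h
  · exact r.refl _

theorem IsFeasible.mem_Icc' {V : Type*} {x : Sym2 V → ℝ} (hx : IsFeasible x) (e : Sym2 V) :
    0 ≤ x e ∧ x e ≤ 1 := by
  induction e with
  | _ u v => exact hx.mem_Icc u v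

open Classical in
/-- The integral LP solution of a clustering. -/
noncomputable def cutMetric {V : Type*} (r : Setoid V) (e : Sym2 V) : ℝ :=
  if Within r e then 0 else 1

theorem cutMetric_isFeasible {V : Type*} (r : Setoid V) : IsFeasible (cutMetric r) where
  triangle u v w := by
    simp only [cutMetric]
    split_ifs with h1 h2 h3 h3 h2 h3 h3
    all_goals first
      | exact absurd ((within_mk r u w).2 (r.trans ((within_mk r u v).1 h2)
          ((within_mk r v w).1 h3))) h1
      | norm_num
  self u := by simp [cutMetric, within_mk]
  mem_Icc u v := by
    simp only [cutMetric]
    split_ifs <;> norm_num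

section Fintype

variable {V : Type*} [Fintype V]

theorem lpCost_cutMetric (I : CorrelationClustering V) (r : Setoid V) :
    I.lpCost (cutMetric r) = I.disagreement r := by
  unfold lpCost disagreement
  rw [Finset.sum_filter, Finset.sum_filter]
  congr 1
  · refine Finset.sum_congr rfl fun e _ => ?_
    by_cases h : Within r e <;> simp [cutMetric, h]
  · refine Finset.sum_congr rfl fun e _ => ?_
    by_cases h : Within r e <;> simp [cutMetric, h]

theorem lpCost_nonneg {I : CorrelationClustering V} (hI : ∀ e, 0 ≤ I.weight e) {x : Sym2 V → ℝ}
    (hx : IsFeasible x) : 0 ≤ I.lpCost x :=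
  add_nonneg (Finset.sum_nonneg fun e _ => mul_nonneg (hI e) (hx.mem_Icc' e).1)
    (Finset.sum_nonneg fun e _ => mul_nonneg (hI e) (sub_nonneg.2 (hx.mem_Icc' e).2))

theorem lpValue_le_lpCost {I : CorrelationClustering V} (hI : ∀ e, 0 ≤ I.weight e) {x : Sym2 V → ℝ}
    (hx : IsFeasible x) : I.lpValue ≤ I.lpCost x := by
  refine csInf_le ⟨0, ?_⟩ ⟨x, hx, rfl⟩
  rintro _ ⟨y, hy, rfl⟩
  exact lpCost_nonneg hI hy

theorem le_optValue {I : CorrelationClustering V} {b : ℝ} (h : ∀ r, b ≤ I.disagreement r) :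
    b ≤ I.optValue :=
  le_csInf (Set.range_nonempty _) (Set.forall_mem_range.2 h)

theorem lpValue_le_optValue {I : CorrelationClustering V} (hI : ∀ e, 0 ≤ I.weight e) :
    I.lpValue ≤ I.optValue :=
  le_optValue fun r => (lpValue_le_lpCost hI (cutMetric_isFeasible r)).trans_eq
    (lpCost_cutMetric I r)

/-- A positive path `u v w` with negative edge `u w` forces a cost of `α`. -/
theorem le_lpValue_ofGraph {G : SimpleGraph V} {α : ℝ} (h0 : 0 ≤ α) (h1 : α ≤ 1) {u v w : V}
    (huv : G.Adj u v) (hvw : G.Adj v w) (huw : u ≠ w) (hn : ¬ G.Adj u w) :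
    α ≤ (ofGraph G α).lpValue := by
  classical
  refine le_csInf (Set.Nonempty.image _ ⟨_, cutMetric_isFeasible ⊤⟩) ?_
  rintro _ ⟨x, hx : IsFeasible x, rfl⟩
  have hneg : s(u, w) ∈ (ofGraph G α).neg.edgeSet :=
    (SimpleGraph.compl_adj _ _ _).2 ⟨huw, hn⟩
  have hne : s(u, v) ≠ s(v, w) := by
    intro h
    rw [Sym2.eq_iff] at h
    rcases h with ⟨h, -⟩ | ⟨h, -⟩
    · exact huv.ne h
    · exact huw h
  have hpos : x s(u, v) + x s(v, w) ≤
      ∑ e ∈ (ofGraph G α).pos.edgeFinset, (ofGraph G α).weight e * x e := by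
    have hsub : ({s(u, v), s(v, w)} : Finset (Sym2 V)) ⊆ (ofGraph G α).pos.edgeFinset := by
      intro e he
      rw [SimpleGraph.mem_edgeFinset]
      rcases Finset.mem_insert.1 he with rfl | he
      · exact huv
      · rw [Finset.mem_singleton.1 he]; exact hvw
    refine le_of_eq_of_le ?_ (Finset.sum_le_sum_of_subset_of_nonneg hsub fun e _ _ =>
      mul_nonneg (ofGraph_weight_nonneg G h0 e) (hx.mem_Icc' e).1)
    rw [Finset.sum_pair hne, ofGraph_weight_of_mem (G := G) α huv,
      ofGraph_weight_of_mem (G := G) α hvw, one_mul,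
      one_mul]
  have hnegsum : α * (1 - x s(u, w)) ≤
      ∑ e ∈ (ofGraph G α).neg.edgeFinset, (ofGraph G α).weight e * (1 - x e) := by
    refine le_of_eq_of_le ?_ (Finset.single_le_sum (f := fun e => (ofGraph G α).weight e * (1 - x e))
      (fun e _ => mul_nonneg (ofGraph_weight_nonneg G h0 e) (sub_nonneg.2 (hx.mem_Icc' e).2))
      (SimpleGraph.mem_edgeFinset.2 hneg))
    rw [ofGraph_weight_of_mem_compl α hneg]
  -- As α ≤ 1, the two positive edges cost at least α times their total length, hence at least α
  -- times the length of `s(u, w)`.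
  have tri := hx.triangle u v w
  have p1 := (hx.mem_Icc' s(u, v)).1
  have p2 := (hx.mem_Icc' s(v, w)).1
  unfold lpCost
  nlinarith

/-! ### Connectedness and induced paths. -/

/-- A nonempty set that no edge leaves has more than half of the vertices, so a component and its
complement cannot both be nonempty. -/
theorem IsCubicExpander.connected [Nonempty V] {G : SimpleGraph V} {h : ℝ}
    (hG : IsCubicExpander G h) (hh : 0 < h) : G.Connected := by
  classical
  refine ⟨fun u v => ?_⟩
  by_contra huv
  have key : ∀ S : Finset V, S.Nonempty → (∀ x ∈ S, ∀ y, G.Adj x y → y ∈ S) →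
      Fintype.card V < 2 * S.card := by
    intro S hS hcl
    by_contra! hle
    have := hG.2 S hle
    have he : (G.interedges S Sᶜ).card = 0 := by
      rw [Finset.card_eq_zero, Finset.eq_empty_iff_forall_notMem]
      rintro ⟨x, y⟩ hxy
      rw [SimpleGraph.mem_interedges_iff, Finset.mem_compl] at hxy
      exact hxy.2.1 (hcl x hxy.1 y hxy.2.2)
    have hpos : (0 : ℝ) < S.card := by exact_mod_cast hS.card_pos
    have hle' : h * (S.card : ℝ) ≤ ((G.interedges S Sᶜ).card : ℝ) := by convert this
    rw [he, Nat.cast_zero] at hle'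
    nlinarith
  have k1 := key (Finset.univ.filter fun x => G.Reachable u x) ⟨u, by simp⟩ (by
    intro x hx y hxy
    simp only [Finset.mem_filter, Finset.mem_univ, true_and] at hx ⊢
    exact hx.trans hxy.reachable)
  have k2 := key (Finset.univ.filter fun x => ¬ G.Reachable u x) ⟨v, by simpa using huv⟩ (by
    intro x hx y hxy
    simp only [Finset.mem_filter, Finset.mem_univ, true_and] at hx ⊢
    exact fun hy => hx (hy.trans hxy.symm.reachable))
  have := Finset.card_filter_add_card_filter_not (s := (Finset.univ : Finset V))
    (fun x => G.Reachable u x)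
  rw [Finset.card_univ] at this
  omega

/-- In a connected cubic graph on more than four vertices some path `u v w` is induced. -/
theorem exists_induced_path [Nonempty V] {G : SimpleGraph V} [G.LocallyFinite]
    (hc : G.Connected) (hG : G.IsRegularOfDegree 3) (hV : 4 < Fintype.card V) :
    ∃ u v w, G.Adj u v ∧ G.Adj v w ∧ u ≠ w ∧ ¬ G.Adj u w := by
  classical
  by_contra! H
  obtain ⟨u⟩ := ‹Nonempty V›
  -- Without induced paths, everything reachable from u is u or one of its three neighbours.
  have key : ∀ w, u = w ∨ G.Adj u w := by
    intro w
    have := (SimpleGraph.reachable_iff_reflTransGen u w).1 (hc.preconnected u w)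
    induction this with
    | refl => exact Or.inl rfl
    | tail _ hbc ih =>
      rcases ih with rfl | hb
      · exact Or.inr hbc
      · exact or_iff_not_imp_left.2 (H _ _ _ hb hbc)
  have : (Finset.univ : Finset V) ⊆ insert u (G.neighborFinset u) := by
    intro w _
    rw [Finset.mem_insert, SimpleGraph.mem_neighborFinset]
    exact (key w).imp Eq.symm id
  have := (Finset.card_le_card this).trans (Finset.card_insert_le _ _)
  rw [SimpleGraph.card_neighborFinset_eq_degree, hG u, Finset.card_univ] at this
  omega

/-! ### Cost of the truncated metric. -/

theorem truncatedMetric_mk {V : Type*} (G : SimpleGraph V) (ε : ℝ) (u v : V) :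
    truncatedMetric G ε s(u, v) = min (ε * (G.dist u v : ℝ)) 1 := rfl

theorem truncatedMetric_isFeasible {V : Type*} {G : SimpleGraph V} (hG : G.Connected) {ε : ℝ}
    (hε : 0 ≤ ε) : IsFeasible (truncatedMetric G ε) where
  triangle u v w := by
    simp only [truncatedMetric_mk]
    have h : (G.dist u w : ℝ) ≤ G.dist u v + G.dist v w := by exact_mod_cast hG.dist_triangle
    have h1 : 0 ≤ ε * (G.dist u v : ℝ) := by positivity
    have h2 : 0 ≤ ε * (G.dist v w : ℝ) := by positivity
    have h3 : ε * (G.dist u w : ℝ) ≤ ε * G.dist u v + ε * G.dist v w := by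
      rw [← mul_add]; gcongr
    rcases min_cases (ε * (G.dist u v : ℝ)) 1 with ⟨e1, _⟩ | ⟨e1, _⟩ <;>
    rcases min_cases (ε * (G.dist v w : ℝ)) 1 with ⟨e2, _⟩ | ⟨e2, _⟩ <;> rw [e1, e2]
    · exact (min_le_left _ _).trans h3
    all_goals
      have := min_le_right (ε * (G.dist u w : ℝ)) 1
      linarith
  self u := by simp [truncatedMetric_mk]
  mem_Icc u v := ⟨le_min (by positivity) zero_le_one, min_le_right _ _⟩

open Classical in
theorem card_dist_eq_le {G : SimpleGraph V} [G.LocallyFinite] (hc : G.Connected)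
    (hG : G.IsRegularOfDegree 3) (u : V) (k : ℕ) :
    (Finset.univ.filter fun v => G.dist u v = k).card ≤ 3 ^ k := by
  induction k with
  | zero =>
    rw [pow_zero, Finset.card_le_one]
    intro x hx y hy
    simp only [Finset.mem_filter, Finset.mem_univ, true_and, hc.dist_eq_zero_iff] at hx hy
    exact hx.symm.trans hy
  | succ k ih =>
    have : (Finset.univ.filter fun v => G.dist u v = k + 1) ⊆
        (Finset.univ.filter fun v => G.dist u v = k).biUnion fun v => G.neighborFinset v := by
      intro v hv
      simp only [Finset.mem_filter, Finset.mem_univ, true_and] at hv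
      obtain ⟨p, hp⟩ := hc.exists_walk_length_eq_dist v u
      rw [SimpleGraph.dist_comm, hv] at hp
      cases p with
      | nil => simp at hp
      | cons hadj q =>
        rename_i x
        rw [SimpleGraph.Walk.length_cons, Nat.add_right_cancel_iff] at hp
        have h1 : G.dist u x ≤ k := by
          rw [SimpleGraph.dist_comm, ← hp]; exact SimpleGraph.dist_le q
        have h2 : G.dist u v ≤ G.dist u x + G.dist x v := hc.dist_triangle
        rw [SimpleGraph.dist_eq_one_iff_adj.2 hadj.symm] at h2
        refine Finset.mem_biUnion.2 ⟨x, ?_, (SimpleGraph.mem_neighborFinset _ _ _).2 hadj.symm⟩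
        simp only [Finset.mem_filter, Finset.mem_univ, true_and]
        omega
    refine (Finset.card_le_card this).trans (Finset.card_biUnion_le.trans ?_)
    simp only [SimpleGraph.card_neighborFinset_eq_degree, hG.degree_eq, Finset.sum_const,
      smul_eq_mul]
    rw [pow_succ]
    exact Nat.mul_le_mul_right 3 ih

open Classical in
theorem card_dist_le_le {G : SimpleGraph V} [G.LocallyFinite] (hc : G.Connected)
    (hG : G.IsRegularOfDegree 3) (u : V) (k : ℕ) :
    (Finset.univ.filter fun v => G.dist u v ≤ k).card ≤ 2 * 3 ^ k := by
  have h : (Finset.univ.filter fun v => G.dist u v ≤ k) ⊆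
      (Finset.range (k + 1)).biUnion fun j => Finset.univ.filter fun v => G.dist u v = j := by
    intro v hv
    simp only [Finset.mem_filter, Finset.mem_univ, true_and] at hv
    exact Finset.mem_biUnion.2 ⟨G.dist u v, Finset.mem_range.2 (by omega), by simp⟩
  refine (Finset.card_le_card h).trans (Finset.card_biUnion_le.trans
    ((Finset.sum_le_sum fun j _ => card_dist_eq_le hc hG u j).trans ?_))
  have : ∀ k : ℕ, ∑ j ∈ Finset.range (k + 1), 3 ^ j ≤ 2 * 3 ^ k := by
    intro k
    induction k with
    | zero => simp
    | succ k ih => rw [Finset.sum_range_succ, pow_succ]; omega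
  exact this k

open Classical in
theorem card_truncatedMetric_lt_one_le {G : SimpleGraph V} [G.LocallyFinite] (hc : G.Connected)
    (hG : G.IsRegularOfDegree 3) (hV : 1 < Fintype.card V) (u : V) :
    ((Finset.univ.filter fun v =>
      truncatedMetric G (2 / Real.logb 3 (Fintype.card V)) s(u, v) < 1).card : ℝ) ≤
      2 * √(Fintype.card V) := by
  have hn : (1 : ℝ) < Fintype.card V := by exact_mod_cast hV
  set L := Real.logb 3 (Fintype.card V) with hL
  have hLpos : 0 < L := Real.logb_pos (by norm_num) hn
  have h3 : (3 : ℝ) ^ ⌊L / 2⌋₊ ≤ √(Fintype.card V) := by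
    apply Real.le_sqrt_of_sq_le
    have h1 : ((⌊L / 2⌋₊ * 2 : ℕ) : ℝ) ≤ L := by
      have := Nat.floor_le (a := L / 2) (by positivity)
      push_cast
      linarith
    rw [← pow_mul, ← Real.rpow_natCast]
    calc (3 : ℝ) ^ ((⌊L / 2⌋₊ * 2 : ℕ) : ℝ) ≤ 3 ^ L :=
          Real.rpow_le_rpow_of_exponent_le (by norm_num) h1
      _ = _ := Real.rpow_logb (by norm_num) (by norm_num) (by linarith)
  -- Length below 1 means distance below L/2; the base 3 of the logarithm matches the growth bound
  -- 3^k for spheres.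
  have hsub : (Finset.univ.filter fun v => truncatedMetric G (2 / L) s(u, v) < 1) ⊆
      Finset.univ.filter fun v => G.dist u v ≤ ⌊L / 2⌋₊ := by
    intro v hv
    simp only [Finset.mem_filter, Finset.mem_univ, true_and, truncatedMetric_mk, min_lt_iff,
      lt_irrefl, or_false] at hv ⊢
    apply Nat.le_floor
    rw [div_mul_eq_mul_div, div_lt_one hLpos] at hv
    linarith
  calc _ ≤ ((2 * 3 ^ ⌊L / 2⌋₊ : ℕ) : ℝ) := by
        exact_mod_cast (Finset.card_le_card hsub).trans (card_dist_le_le hc hG u _)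
    _ = 2 * 3 ^ ⌊L / 2⌋₊ := by push_cast; rfl
    _ ≤ _ := by gcongr

theorem lpCost_truncatedMetric_le {G : SimpleGraph V} [G.LocallyFinite] (hc : G.Connected)
    (hG : G.IsRegularOfDegree 3) (hV : 1 < Fintype.card V) {α : ℝ} (hα : 0 ≤ α) :
    (ofGraph G α).lpCost (truncatedMetric G (2 / Real.logb 3 (Fintype.card V))) ≤
      3 * Fintype.card V / Real.logb 3 (Fintype.card V) +
        2 * α * Fintype.card V * √(Fintype.card V) := by
  classical
  have hn : (1 : ℝ) < Fintype.card V := by exact_mod_cast hV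
  have hLpos : 0 < Real.logb 3 (Fintype.card V) := Real.logb_pos (by norm_num) hn
  have small := card_truncatedMetric_lt_one_le hc hG hV
  set L := Real.logb 3 (Fintype.card V) with hL
  have feas := truncatedMetric_isFeasible hc (ε := 2 / L) (by positivity)
  set x := truncatedMetric G (2 / L) with hx
  unfold lpCost
  refine add_le_add ?_ ?_
  · have hle : ∀ e ∈ (ofGraph G α).pos.edgeFinset, (ofGraph G α).weight e * x e ≤ 2 / L := by
      intro e he
      rw [SimpleGraph.mem_edgeFinset] at he
      rw [ofGraph_weight_of_mem α he, one_mul]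
      induction e with
      | _ u v =>
        have hd : G.dist u v = 1 := SimpleGraph.dist_eq_one_iff_adj.2 he
        rw [hx, truncatedMetric_mk, hd, Nat.cast_one, mul_one]
        exact min_le_left _ _
    refine (Finset.sum_le_card_nsmul _ _ _ hle).trans_eq ?_
    have h1 : Fintype.card V * 3 = 2 * G.edgeFinset.card := by
      rw [← G.sum_degrees_eq_twice_card_edges, ← Finset.card_univ, ← smul_eq_mul,
        ← Finset.sum_const]
      refine Finset.sum_congr rfl fun v _ => ?_
      rw [← hG v]
      congr!
    have h3 : (ofGraph G α).pos.edgeFinset.card = G.edgeFinset.card := by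
      unfold SimpleGraph.edgeFinset
      congr!
    rw [nsmul_eq_mul, h3, mul_div_assoc']
    have h4 : (Fintype.card V : ℝ) * 3 = 2 * G.edgeFinset.card := by exact_mod_cast h1
    rw [mul_comm 3, h4, mul_comm 2]
  · set E := (ofGraph G α).neg.edgeFinset.filter fun e => x e < 1 with hE
    set P := Finset.univ.filter fun p : V × V => x s(p.1, p.2) < 1 with hP
    have hEP : E.card ≤ P.card := by
      have : E ⊆ P.image fun p => s(p.1, p.2) := by
        intro e he
        induction e with
        | _ u v =>
          exact Finset.mem_image.2 ⟨(u, v), by simpa [hP] using (Finset.mem_filter.1 he).2, rfl⟩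
      exact (Finset.card_le_card this).trans Finset.card_image_le
    have hPc : (P.card : ℝ) ≤ Fintype.card V * (2 * √(Fintype.card V)) := by
      have : P.card = ∑ u : V, (Finset.univ.filter fun v => x s(u, v) < 1).card := by
        simp only [hP, Finset.card_filter]
        exact Fintype.sum_prod_type _
      rw [this, Nat.cast_sum]
      refine (Finset.sum_le_card_nsmul _ _ _ fun u _ => small u).trans_eq ?_
      rw [nsmul_eq_mul, Finset.card_univ]
    calc ∑ e ∈ (ofGraph G α).neg.edgeFinset, (ofGraph G α).weight e * (1 - x e)
        ≤ ∑ e ∈ (ofGraph G α).neg.edgeFinset, if x e < 1 then α else 0 := by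
          refine Finset.sum_le_sum fun e he => ?_
          rw [ofGraph_weight_of_mem_compl α ((SimpleGraph.mem_edgeFinset (G := (ofGraph G α).neg)).1 he)]
          obtain ⟨h0, h1⟩ := feas.mem_Icc' e
          split_ifs with h
          · nlinarith
          · rw [le_antisymm h1 (not_lt.1 h)]; simp
      _ = E.card * α := by rw [← Finset.sum_filter, Finset.sum_const, nsmul_eq_mul]
      _ ≤ P.card * α := by gcongr
      _ ≤ Fintype.card V * (2 * √(Fintype.card V)) * α := by gcongr
      _ = _ := by ring

/-! ### Lower bound for every clustering. -/

open Classical in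
theorem card_filter_mk_mem_le (E : Finset (Sym2 V)) :
    (Finset.univ.filter fun p : V × V => s(p.1, p.2) ∈ E).card ≤ 2 * E.card := by
  refine Finset.card_le_mul_card_image_of_maps_to (f := fun p : V × V => s(p.1, p.2))
    (fun p hp => (Finset.mem_filter.1 hp).2) 2 fun e _ => ?_
  induction e with
  | _ u v =>
    refine (Finset.card_le_card (t := {(u, v), (v, u)}) ?_).trans Finset.card_le_two
    rintro ⟨x, y⟩ h
    have := (Finset.mem_filter.1 h).2
    simpa [Sym2.eq_iff] using this

/-- If no cluster has more than half of the vertices, then many positive edges are cut. -/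
theorem le_disagreement_of_small {G : SimpleGraph V} {h : ℝ} (hG : IsCubicExpander G h) {α : ℝ}
    (hα : 0 ≤ α) (r : Setoid V)
    (hr : ∀ S : Finset V, (∀ u ∈ S, ∀ v ∈ S, r u v) → 2 * S.card ≤ Fintype.card V) :
    h / 2 * Fintype.card V ≤ (ofGraph G α).disagreement r := by
  classical
  set E := (ofGraph G α).pos.edgeFinset.filter fun e => ¬ Within r e with hE
  set D := Finset.univ.filter fun p : V × V => s(p.1, p.2) ∈ E with hD
  have hcost : (E.card : ℝ) ≤ (ofGraph G α).disagreement r := by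
    unfold disagreement
    have h1 : ∑ e ∈ E, (ofGraph G α).weight e = E.card := by
      rw [Finset.sum_congr rfl fun e he => ofGraph_weight_of_mem α
        (SimpleGraph.mem_edgeFinset.1 (Finset.mem_filter.1 he).1), Finset.sum_const,
        nsmul_eq_mul, mul_one]
    have h2 : 0 ≤ ∑ e ∈ (ofGraph G α).neg.edgeFinset with Within r e, (ofGraph G α).weight e :=
      Finset.sum_nonneg fun e _ => ofGraph_weight_nonneg G hα e
    linarith
  have hDE : D.card ≤ 2 * E.card := card_filter_mk_mem_le E
  let S (q : Quotient r) : Finset V := Finset.univ.filter fun v => (⟦v⟧ : Quotient r) = q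
  have hS : ∀ q u, u ∈ S q ↔ (⟦u⟧ : Quotient r) = q := by simp [S]
  have hsmall : ∀ q, h * (S q).card ≤ ((D.filter fun p => (⟦p.1⟧ : Quotient r) = q).card : ℝ) := by
    intro q
    refine (hG.2 (S q) (hr _ ?_)).trans ?_
    · intro u hu v hv
      exact Quotient.exact (((hS q u).1 hu).trans ((hS q v).1 hv).symm)
    · refine Nat.cast_le.2 (Finset.card_le_card ?_)
      rintro ⟨u, v⟩ huv
      rw [SimpleGraph.mem_interedges_iff] at huv
      obtain ⟨hu, hv, hadj⟩ := huv
      rw [Finset.mem_compl, hS] at hv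
      rw [hS] at hu
      simp only [hD, hE, Finset.mem_filter, Finset.mem_univ, true_and, within_mk]
      refine ⟨⟨SimpleGraph.mem_edgeFinset.2 hadj, fun hr => hv ?_⟩, hu⟩
      exact (Quotient.sound hr).symm.trans hu
  -- Sort the ordered cut pairs by the cluster of their first vertex, and the vertices by their
  -- cluster. Ordered pairs count each cut edge twice, whence the factor 1/2 in the result.
  have hsum : h * Fintype.card V ≤ D.card := by
    rw [Finset.card_eq_sum_card_fiberwise (s := D) (t := Finset.univ)
        (f := fun p => (⟦p.1⟧ : Quotient r)) (by simp [Set.MapsTo]),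
      ← Finset.card_univ, Finset.card_eq_sum_card_fiberwise (s := (Finset.univ : Finset V))
        (t := Finset.univ) (f := fun v => (⟦v⟧ : Quotient r)) (by simp [Set.MapsTo]),
      Nat.cast_sum, Nat.cast_sum, Finset.mul_sum]
    exact Finset.sum_le_sum fun q _ => hsmall q
  have : (D.card : ℝ) ≤ 2 * E.card := by exact_mod_cast hDE
  linarith

/-- If a cluster has more than half of the vertices, then it contains many negative edges. -/
theorem le_disagreement_of_large {G : SimpleGraph V} [G.LocallyFinite]
    (hG : G.IsRegularOfDegree 3) {α : ℝ} (hα : 0 ≤ α) (hV : 16 ≤ Fintype.card V) (r : Setoid V)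
    (S : Finset V) (hS : ∀ u ∈ S, ∀ v ∈ S, r u v) (hSV : Fintype.card V < 2 * S.card) :
    α * (Fintype.card V : ℝ) ^ 2 / 16 ≤ (ofGraph G α).disagreement r := by
  classical
  set E := (ofGraph G α).neg.edgeFinset.filter fun e => Within r e with hE
  have hcost : E.card * α ≤ (ofGraph G α).disagreement r := by
    unfold disagreement
    have h1 : ∑ e ∈ E, (ofGraph G α).weight e = E.card * α := by
      rw [Finset.sum_congr rfl fun e he => ofGraph_weight_of_mem_compl α
        (SimpleGraph.mem_edgeFinset.1 (Finset.mem_filter.1 he).1), Finset.sum_const,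
        nsmul_eq_mul]
    have h2 : 0 ≤ ∑ e ∈ (ofGraph G α).pos.edgeFinset with ¬ Within r e, (ofGraph G α).weight e :=
      Finset.sum_nonneg fun e _ => ofGraph_weight_nonneg G hα e
    linarith
  -- For each u, at most u and its three neighbours are lost, so at least |S| - 4 negative partners
  -- remain in S.
  set P := S.sigma fun u => S \ insert u (G.neighborFinset u) with hP
  have hPE : P.card ≤ 2 * E.card := by
    refine (Finset.card_le_card_of_injOn (fun p => (p.1, p.2)) ?_ ?_).trans
      (card_filter_mk_mem_le E)
    · rintro ⟨u, v⟩ huv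
      simp only [hP, Finset.mem_coe, Finset.mem_sigma, Finset.mem_sdiff, Finset.mem_insert,
        SimpleGraph.mem_neighborFinset, not_or] at huv
      simp only [hE, Finset.mem_coe, Finset.mem_filter, Finset.mem_univ, true_and, within_mk]
      refine ⟨SimpleGraph.mem_edgeFinset.2 ((SimpleGraph.compl_adj _ _ _).2 ⟨fun h => huv.2.2.1 h.symm, huv.2.2.2⟩),
        hS u huv.1 v huv.2.1⟩
    · rintro ⟨u, v⟩ _ ⟨u', v'⟩ _ h
      simpa using h
  have hSP : S.card * (S.card - 4) ≤ P.card := by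
    rw [hP, Finset.card_sigma]
    refine le_of_eq_of_le (by rw [Finset.sum_const, smul_eq_mul])
      (Finset.sum_le_sum (f := fun _ => S.card - 4) fun u _ => ?_)
    have h1 := Finset.le_card_sdiff (insert u (G.neighborFinset u)) S
    have h2 := Finset.card_insert_le u (G.neighborFinset u)
    rw [SimpleGraph.card_neighborFinset_eq_degree, hG u] at h2
    omega
  have h4 : 4 ≤ S.card := by omega
  have hle : (S.card : ℝ) * (S.card - 4) ≤ 2 * E.card := by
    have := hSP.trans hPE
    rw [← Nat.cast_ofNat (R := ℝ) (n := 4), ← Nat.cast_sub h4]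
    exact_mod_cast this
  have hn : (16 : ℝ) ≤ Fintype.card V := by exact_mod_cast hV
  have hs : (Fintype.card V : ℝ) ≤ 2 * S.card := by exact_mod_cast hSV.le
  -- Here |S| ≥ n/2 and, as n ≥ 16, |S| - 4 ≥ n/4.
  have hquad : (Fintype.card V : ℝ) ^ 2 / 16 ≤ E.card := by nlinarith
  calc α * (Fintype.card V : ℝ) ^ 2 / 16 = (Fintype.card V : ℝ) ^ 2 / 16 * α := by ring
    _ ≤ E.card * α := by gcongr
    _ ≤ _ := hcost

theorem IsCubicExpander.le_disagreement {G : SimpleGraph V} {h : ℝ} (hG : IsCubicExpander G h)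
    {α : ℝ} (hα : 0 ≤ α) (hV : 16 ≤ Fintype.card V) (hαV : 16 ≤ α * Fintype.card V)
    (r : Setoid V) : min (h / 2) 1 * Fintype.card V ≤ (ofGraph G α).disagreement r := by
  classical
  by_cases hr : ∀ S : Finset V, (∀ u ∈ S, ∀ v ∈ S, r u v) → 2 * S.card ≤ Fintype.card V
  · refine le_trans ?_ (le_disagreement_of_small hG hα r hr)
    gcongr
    exact min_le_left _ _
  · push Not at hr
    obtain ⟨S, hS, hSV⟩ := hr
    refine le_trans ?_ (le_disagreement_of_large hG.1 hα hV r S hS hSV)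
    calc min (h / 2) 1 * (Fintype.card V : ℝ) ≤ 1 * Fintype.card V := by
          gcongr
          exact min_le_right _ _
      _ ≤ α * (Fintype.card V : ℝ) ^ 2 / 16 := by nlinarith

end Fintype

end CorrelationClustering

/-! ### Choice of constants and the integrality gap. -/

namespace CorrelationClustering

/-- Since |α^(1/4) log α| < 4 on (0, 1], the quantity is at most 16√α. -/
theorem exists_forall_mul_log_sq_le {ε : ℝ} (hε : 0 < ε) :
    ∃ α₀ : ℝ, 0 < α₀ ∧ α₀ < 1 ∧ ∀ α : ℝ, 0 < α → α ≤ α₀ → α * Real.log α ^ 2 ≤ ε := by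
  refine ⟨min (1 / 2) ((ε / 16) ^ 2), by positivity, (min_le_left _ _).trans_lt (by norm_num),
    fun α h0 h1 => ?_⟩
  have h2 : α ≤ 1 := (h1.trans (min_le_left _ _)).trans (by norm_num)
  have h3 : √α ≤ ε / 16 := by
    rw [Real.sqrt_le_left (by positivity)]
    exact h1.trans (min_le_right _ _)
  have h4 := (Real.abs_log_mul_self_rpow_lt α (1 / 4) h0 h2 (by norm_num)).le
  have h5 : (Real.log α * α ^ (1 / 4 : ℝ)) ^ 2 ≤ 16 := by
    rw [← sq_abs]
    nlinarith [abs_nonneg (Real.log α * α ^ (1 / 4 : ℝ))]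
  have h6 : (α ^ (1 / 4 : ℝ)) ^ 2 = √α := by
    rw [Real.sqrt_eq_rpow, ← Real.rpow_natCast, ← Real.rpow_mul h0.le]
    norm_num
  rw [mul_pow, h6] at h5
  calc α * Real.log α ^ 2 = √α * (Real.log α ^ 2 * √α) := by
        nth_rw 1 [← Real.mul_self_sqrt h0.le]; ring
    _ ≤ ε / 16 * 16 := by gcongr
    _ = ε := by ring

theorem exists_expander_family : ∃ h a b α₀ : ℝ, 0 < h ∧ 0 < a ∧ 0 < b ∧ 0 < α₀ ∧ α₀ < 1 ∧
    ∀ α : ℝ, 0 < α → α ≤ α₀ → ∃ (n : ℕ) (G : SimpleGraph (Fin n)), IsCubicExpander G h ∧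
      a / (α * Real.log α) ^ 2 ≤ n ∧ (n : ℝ) ≤ b / (α * Real.log α) ^ 2 := by
  -- Take n = 40⌈X⌉ with X = (α log α)⁻². As |α log α| ≤ 1, X ≥ 1 and ⌈X⌉ ≤ 2X.
  refine ⟨1 / 120, 40, 80, 1 / 2, by norm_num, by norm_num, by norm_num, by norm_num, by norm_num,
    fun α h0 h1 => ?_⟩
  obtain ⟨G, hG⟩ := exists_isCubicExpander ⌈1 / (α * Real.log α) ^ 2⌉₊
  refine ⟨_, G, hG, ?_⟩
  have hlog : Real.log α < 0 := Real.log_neg h0 (by linarith)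
  have hpos : 0 < (α * Real.log α) ^ 2 := by
    have := (mul_neg_of_pos_of_neg h0 hlog).ne
    positivity
  have hle : (α * Real.log α) ^ 2 ≤ 1 := by
    rw [mul_comm, ← sq_abs]
    exact pow_le_one₀ (abs_nonneg _) (Real.abs_log_mul_self_lt α h0 (by linarith)).le
  have hX : 1 ≤ 1 / (α * Real.log α) ^ 2 := by rwa [le_div_iff₀ hpos, one_mul]
  have l1 := Nat.le_ceil (1 / (α * Real.log α) ^ 2)
  have l2 := Nat.ceil_lt_add_one (zero_le_one.trans hX)
  rw [div_eq_mul_one_div 40, div_eq_mul_one_div 80]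
  push_cast
  constructor <;> linarith

theorem exists_gap_of_expander {h a b : ℝ} (hh : 0 < h) (ha : 0 < a) (hb : 0 < b) :
    ∃ c C α₀ : ℝ, 0 < c ∧ 0 < C ∧ 0 < α₀ ∧ α₀ < 1 ∧
      ∀ α : ℝ, 0 < α → α ≤ α₀ → ∀ (n : ℕ) (G : SimpleGraph (Fin n)), IsCubicExpander G h →
        a / (α * Real.log α) ^ 2 ≤ n → (n : ℝ) ≤ b / (α * Real.log α) ^ 2 →
        (ofGraph G α).IsAsymmetric α ∧
        IsFeasible (truncatedMetric G (2 / Real.logb 3 n)) ∧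
        (ofGraph G α).lpCost (truncatedMetric G (2 / Real.logb 3 n)) ≤
          C * (n / Real.log (1 / α)) ∧
        (∀ r : Setoid (Fin n), c * n ≤ (ofGraph G α).disagreement r) ∧
        0 < (ofGraph G α).lpValue ∧
        c * Real.log (1 / α) * (ofGraph G α).lpValue ≤ (ofGraph G α).optValue := by
  classical
  -- The lower bound on n gives αn ≥ a / (α log² α), so a/16 is the threshold for αn ≥ 16.
  obtain ⟨α₀, h0, h1, hα₀⟩ := exists_forall_mul_log_sq_le (ε := a / 16) (by positivity)
  have hlog3 : 0 < Real.log 3 := Real.log_pos (by norm_num)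
  set m := min (h / 2) 1 with hm
  have hm0 : 0 < m := lt_min (by positivity) one_pos
  -- The first term pays for the positive edges, using log n ≥ log(1/α); the second for the negative
  -- ones, using √n ≤ √b / (α log(1/α)).
  set C := 3 * Real.log 3 + 2 * √b with hC
  have hC0 : 0 < C := by positivity
  refine ⟨min m (m / C), C, α₀, lt_min hm0 (by positivity), hC0, h0, h1, ?_⟩
  intro α hα hαα₀ n G hG hna hnb
  have hα1 : α < 1 := hαα₀.trans_lt h1
  have hαL := hα₀ α hα hαα₀
  have hlog : Real.log (1 / α) = -Real.log α := by rw [one_div, Real.log_inv]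
  set L := Real.log (1 / α) with hL
  have hL0 : 0 < L := Real.log_pos (by rwa [lt_div_iff₀ hα, one_mul])
  have hsq : (α * Real.log α) ^ 2 = (α * L) ^ 2 := by rw [hlog]; ring
  rw [hsq] at hna hnb
  have hαn : 16 ≤ α * n := by
    have h2 : Real.log α ^ 2 = L ^ 2 := by rw [hlog]; ring
    rw [h2] at hαL
    rw [div_le_iff₀ (by positivity)] at hna
    have h3 : a ≤ α * n * (α * L ^ 2) := by linarith [hna]
    have h4 : α * n * (α * L ^ 2) ≤ α * n * (a / 16) := by gcongr
    nlinarith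
  have hn16 : (16 : ℝ) ≤ n := by nlinarith [(Nat.cast_nonneg n : (0 : ℝ) ≤ n)]
  have hn : 16 ≤ n := by exact_mod_cast hn16
  have : Nonempty (Fin n) := ⟨⟨0, by omega⟩⟩
  have hconn := hG.connected hh
  have hlogn : L ≤ Real.log n := by
    refine Real.log_le_log (by positivity) ?_
    rw [div_le_iff₀ hα]
    linarith
  have hlogb : L / Real.log 3 ≤ Real.logb 3 n := by
    unfold Real.logb
    gcongr
  have hlogb0 : 0 < Real.logb 3 n := lt_of_lt_of_le (by positivity) hlogb
  have feas := truncatedMetric_isFeasible hconn (ε := 2 / Real.logb 3 n) (by positivity)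
  have hcost : (ofGraph G α).lpCost (truncatedMetric G (2 / Real.logb 3 n)) ≤ C * (n / L) := by
    have := lpCost_truncatedMetric_le hconn hG.1 (by rw [Fintype.card_fin]; omega) hα.le
    rw [Fintype.card_fin] at this
    refine this.trans ?_
    have e1 : 3 * (n : ℝ) / Real.logb 3 n ≤ 3 * n / (L / Real.log 3) := by gcongr
    have e2 : √(n : ℝ) ≤ √b / (α * L) := by
      refine (Real.sqrt_le_sqrt hnb).trans_eq ?_
      rw [Real.sqrt_div hb.le, Real.sqrt_sq (by positivity)]
    have e3 : 2 * α * n * √(n : ℝ) ≤ 2 * α * n * (√b / (α * L)) := by gcongr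
    refine (add_le_add e1 e3).trans_eq ?_
    rw [hC]
    field_simp
  have hdis : ∀ r : Setoid (Fin n), m * n ≤ (ofGraph G α).disagreement r := by
    intro r
    have := hG.le_disagreement hα.le (by rwa [Fintype.card_fin]) (by rwa [Fintype.card_fin]) r
    rwa [Fintype.card_fin] at this
  have hlp : 0 < (ofGraph G α).lpValue := by
    obtain ⟨u, v, w, huv, hvw, huw, hn⟩ :=
      exists_induced_path hconn hG.1 (by rw [Fintype.card_fin]; omega)
    exact hα.trans_le (le_lpValue_ofGraph hα.le hα1.le huv hvw huw hn)
  refine ⟨ofGraph_isAsymmetric G hα1.le, feas, hcost, fun r => ?_, hlp, ?_⟩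
  · refine le_trans ?_ (hdis r)
    gcongr
    exact min_le_left _ _
  · refine le_trans ?_ (le_optValue hdis)
    calc min m (m / C) * L * (ofGraph G α).lpValue ≤ m / C * L * (C * (n / L)) := by
          gcongr
          · exact min_le_right _ _
          · exact (lpValue_le_lpCost (ofGraph_weight_nonneg G hα.le) feas).trans hcost
      _ = m * n := by field_simp

/-- Covers the α too large for the expander construction, where a gap of 1 is enough. -/
theorem exists_lpValue_pos_le_optValue {α : ℝ} (h0 : 0 < α) (h1 : α ≤ 1) :
    ∃ I : CorrelationClustering (Fin 3), I.IsAsymmetric α ∧ 0 < I.lpValue ∧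
      I.lpValue ≤ I.optValue := by
  let G : SimpleGraph (Fin 3) := SimpleGraph.fromEdgeSet {s(0, 1), s(1, 2)}
  exact ⟨ofGraph G α, ofGraph_isAsymmetric G h1,
    h0.trans_le (le_lpValue_ofGraph (G := G) (u := 0) (v := 1) (w := 2) h0.le h1
      (by simp [G]) (by simp [G]) (by decide) (by simp [G])),
    lpValue_le_optValue (ofGraph_weight_nonneg G h0.le)⟩

theorem exists_integrality_gap : ∃ c : ℝ, 0 < c ∧ ∀ α : ℝ, 0 < α → α ≤ 1 →
    ∃ (n : ℕ) (I : CorrelationClustering (Fin n)), I.IsAsymmetric α ∧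
      0 < I.lpValue ∧ c * Real.log (1 / α) * I.lpValue ≤ I.optValue := by
  obtain ⟨h, a, b, α₁, hh, ha, hb, h1, h1', exp⟩ := exists_expander_family
  obtain ⟨c, C, α₂, hc, -, h2, -, gap⟩ := exists_gap_of_expander hh ha hb
  set α₀ := min α₁ α₂ with hα₀
  have h0 : 0 < α₀ := lt_min h1 h2
  have hL0 : 0 < Real.log (1 / α₀) := Real.log_pos (by
    rw [lt_div_iff₀ h0, one_mul]
    exact (min_le_left _ _).trans_lt h1')
  -- The second bound makes the required gap at most 1 when α > α₀.
  refine ⟨min c (1 / Real.log (1 / α₀)), lt_min hc (by positivity), fun α hα hα1 => ?_⟩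
  have hL : 0 ≤ Real.log (1 / α) := Real.log_nonneg (by rwa [le_div_iff₀ hα, one_mul])
  rcases le_or_gt α α₀ with hle | hlt
  · obtain ⟨n, G, hG, hna, hnb⟩ := exp α hα (hle.trans (min_le_left _ _))
    obtain ⟨asym, -, -, -, pos, opt⟩ := gap α hα (hle.trans (min_le_right _ _)) n G hG hna hnb
    refine ⟨n, _, asym, pos, le_trans ?_ opt⟩
    gcongr
    exact min_le_left _ _
  · obtain ⟨I, asym, pos, opt⟩ := exists_lpValue_pos_le_optValue hα hα1
    refine ⟨3, I, asym, pos, le_trans ?_ opt⟩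
    refine mul_le_of_le_one_left pos.le ?_
    calc min c (1 / Real.log (1 / α₀)) * Real.log (1 / α)
        ≤ 1 / Real.log (1 / α₀) * Real.log (1 / α₀) := by
          gcongr
          exact min_le_right _ _
      _ = 1 := by field_simp

end CorrelationClustering

theorem theorem3 :
    -- for each `α` there is an instance with integrality gap at least `c log (1 / α)`
    (∃ c : ℝ, 0 < c ∧ ∀ α : ℝ, 0 < α → α ≤ 1 →
      ∃ (n : ℕ) (I : CorrelationClustering (Fin n)), I.IsAsymmetric α ∧
        0 < I.lpValue ∧ c * Real.log (1 / α) * I.lpValue ≤ I.optValue) ∧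
    -- there are 3-regular expanders on `Θ((α log α)⁻²)` vertices
    (∃ h a b α₀ : ℝ, 0 < h ∧ 0 < a ∧ 0 < b ∧ 0 < α₀ ∧ α₀ < 1 ∧
      ∀ α : ℝ, 0 < α → α ≤ α₀ → ∃ (n : ℕ) (G : SimpleGraph (Fin n)),
        CorrelationClustering.IsCubicExpander G h ∧
        a / (α * Real.log α) ^ 2 ≤ n ∧ (n : ℝ) ≤ b / (α * Real.log α) ^ 2) ∧
    -- each of them has the claimed LP solution, integral cost and integrality gap
    (∀ h a b : ℝ, 0 < h → 0 < a → 0 < b →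
      ∃ c C α₀ : ℝ, 0 < c ∧ 0 < C ∧ 0 < α₀ ∧ α₀ < 1 ∧
        ∀ α : ℝ, 0 < α → α ≤ α₀ → ∀ (n : ℕ) (G : SimpleGraph (Fin n)),
          CorrelationClustering.IsCubicExpander G h →
          a / (α * Real.log α) ^ 2 ≤ n → (n : ℝ) ≤ b / (α * Real.log α) ^ 2 →
          (CorrelationClustering.ofGraph G α).IsAsymmetric α ∧
          CorrelationClustering.IsFeasible
            (CorrelationClustering.truncatedMetric G (2 / Real.logb 3 n)) ∧
          (CorrelationClustering.ofGraph G α).lpCost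
            (CorrelationClustering.truncatedMetric G (2 / Real.logb 3 n)) ≤
              C * (n / Real.log (1 / α)) ∧
          (∀ r : Setoid (Fin n), c * n ≤ (CorrelationClustering.ofGraph G α).disagreement r) ∧
          0 < (CorrelationClustering.ofGraph G α).lpValue ∧
          c * Real.log (1 / α) * (CorrelationClustering.ofGraph G α).lpValue ≤
            (CorrelationClustering.ofGraph G α).optValue) :=
  ⟨CorrelationClustering.exists_integrality_gap, CorrelationClustering.exists_expander_family,
    fun _ _ _ => CorrelationClustering.exists_gap_of_expander⟩
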